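/- Theorem 2 (decentralized achievability). Let $K\in\mathbb N$ users participate in a computation over $N$ files, and let $0<\mu<1$ be fixed. For every user $k$ and file $n$ there is an arbitrary $T$-bit intermediate value $v_{k,n}$ (the output of a Map function). User $k$ stores a set $\mathcal U_k$ of $\lfloor\mu N\rfloor$ files (that is, $\mu N$ files when this is an integer), knows $v_{q,n}$ for all $q$ and all $n\in\mathcal U_k$, and needs $v_{k,n}$ for all available files $n\in\bigcup_i\mathcal U_i$. The users communicate through an access point: they send it uplink messages that depend only on what they know, and it broadcasts to all of them a downlink message that depends only on the uplink messages. The uplink load $L_u$ is the total number of bits of the uplink messages divided by $NT$, the downlink load $L_d$ is the number of bits of the downlink message divided by $NT$, and the information loss $\Delta$ is the fraction of the files that no user stores. The decentralized coded scheme is as follows. The sets $\mathcal U_1,\dots,\mathcal U_K$ are independent and uniformly random among the sets of $\lfloor\mu N\rfloor$ files. For every set $S$ of at least two users and every $k\in S$, the bits of the values $v_{k,n}$ for the files $n$ stored by all users in $S\setminus\{k\}$ and by no other user are split, arbitrarily but evenly (sizes differ by at most one bit), into disjoint segments $\mathcal V^k_{S\setminus\{k\},i}$, $i\in S\setminus\{k\}$.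 User $i\in S$ sends $W_i^S=\bigoplus_{k\in S\setminus\{i\}}\mathcal V^k_{S\setminus\{k\},i}$, where the segments are zero-padded to the longest among them. The access point broadcasts $|S|-1$ linear combinations of $W_i^S$, $i\in S$, zero-padded to a common length and read as vectors over the field $\mathbb F_{2^q}$, with independent coefficients uniform in $\mathbb F_{2^q}$ that are known to all users. Let $T=T_N\ge 1$ and $q=q_N$ be any sequences such that $q_N\to\infty$ and $q_N=o(N\,T_N)$ (for example, $T$ constant and $q_N=\lceil\log_2 (N+1)\rceil$), and let the splittings be any even ones. Then for every $\varepsilon>0$, with probability tending to $1$ as $N\to\infty$, every user can recover all the intermediate values it needs from the downlink message and its own values, whatever the intermediate values are, and $\Delta$, $L_u$ and $L_d$ are within $\varepsilon$ of, respectively, $$(1-\mu)^K,\qquad \sum_{j=1}^{K-1}\binom{K}{j+1}\frac{j+1}{j}\,\mu^j(1-\mu)^{K-j},\qquad \sum_{j=1}^{K-1}\binom{K}{j+1}\,\mu^j(1-\mu)^{K-j}.$$ -/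

import Mathlib

open Filter Topology MeasureTheory ProbabilityTheory Asymptotics

noncomputable section

namespace CWDC

/-! ### The distributed computing model -/

/-- A dataset placement: user `k` stores the files whose indices are in `U k`. -/
abbrev Placement (K N : ℕ) := Fin K → Finset (Fin N)

/-- The intermediate values: `v k n` is the `T`-bit value of the Map function of file `n` at the
input of user `k`.  The Map functions are unconstrained, so these values are arbitrary. -/
abbrev Values (K N T : ℕ) := Fin K → Fin N → Fin T → ZMod 2

/-- What user `i` computes in the Map phase: the intermediate values, for the inputs of all users,
of the files that user `i` stores. -/
abbrev LocalValues {K N : ℕ} (T : ℕ) (U : Placement K N) (i : Fin K) :=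
  Fin K → {n : Fin N // n ∈ U i} → Fin T → ZMod 2

/-- The result of the Map phase at user `i`. -/
def localValues {K N T : ℕ} (U : Placement K N) (i : Fin K) (v : Values K N T) :
    LocalValues T U i :=
  fun k n => v k n.1

/-- The files that are stored by at least one user. -/
def available {K N : ℕ} (U : Placement K N) : Finset (Fin N) :=
  Finset.univ.filter fun n => ∃ k, n ∈ U k

/-- The information loss: the fraction of the files that no user stores. -/
def informationLoss {K N : ℕ} (U : Placement K N) : ℝ :=
  ((Finset.univ.filter fun n : Fin N => ∀ k, n ∉ U k).card : ℝ) / N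

/-- A Shuffle phase for the placement `U`.  User `k` encodes its local values into an uplink message
with one bit for every element of `UpBit k`; the access point turns the uplink messages into a
broadcast message with one bit for every element of `DownBit`. -/
structure ShuffleScheme {K N : ℕ} (T : ℕ) (U : Placement K N) where
  /-- bit positions of the uplink message of a user -/
  UpBit : Fin K → Type
  /-- bit positions of the downlink message -/
  DownBit : Type
  upFintype : ∀ k, Fintype (UpBit k)
  downFintype : Fintype DownBit
  /-- the uplink encoder of a user -/
  encode : ∀ k, LocalValues T U k → (UpBit k → ZMod 2)
  /-- the map from the uplink messages to the downlink message applied at the access point -/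
  relay : (∀ k, UpBit k → ZMod 2) → (DownBit → ZMod 2)

namespace ShuffleScheme

variable {K N T : ℕ} {U : Placement K N}

/-- Number of bits of all uplink messages, normalized by `N * T`. -/
def uplinkLoad (s : ShuffleScheme T U) : ℝ :=
  ((∑ k, @Fintype.card (s.UpBit k) (s.upFintype k) : ℕ) : ℝ) / (N * T)

/-- Number of bits of the downlink message, normalized by `N * T`. -/
def downlinkLoad (s : ShuffleScheme T U) : ℝ :=
  (@Fintype.card s.DownBit s.downFintype : ℝ) / (N * T)

/-- The downlink message when the intermediate values are `v`. -/
def downlinkMessage (s : ShuffleScheme T U) (v : Values K N T) : s.DownBit → ZMod 2 :=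
  s.relay fun k => s.encode k (localValues U k v)

/-- The Shuffle phase succeeds: from the downlink message and its local values, every user can
construct the inputs of its Reduce function, that is, its intermediate values in all available
files, whatever the intermediate values are. -/
def Succeeds (s : ShuffleScheme T U) : Prop :=
  ∀ k : Fin K, ∃ dec : (s.DownBit → ZMod 2) → LocalValues T U k →
      {n : Fin N // n ∈ available U} → Fin T → ZMod 2,
    ∀ (v : Values K N T) (n : {n : Fin N // n ∈ available U}),
      dec (s.downlinkMessage v) (localValues U k v) n = v k n.1

end ShuffleScheme

/-! ### The coded scheme -/

/-- The files stored exclusively by the users in `W`: by all users in `W`, by none outside. -/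
def exclusive {K N : ℕ} (U : Placement K N) (W : Finset (Fin K)) : Finset (Fin N) :=
  Finset.univ.filter fun n => (∀ i ∈ W, n ∈ U i) ∧ ∀ i, i ∉ W → n ∉ U i

/-- For every set `S` of at least two users and every `k ∈ S`, an even splitting of the bits of the
values needed by `k` and known exclusively by the users of `S \ {k}` into disjoint segments, one for
each `i ∈ S \ {k}`.  A bit is given by its file and its position in the intermediate value
(of user `k`) of this file.  Even means that the numbers of bits of the segments are equal up to
the rounding to integers. -/
structure EvenSplit {K N : ℕ} (T : ℕ) (U : Placement K N) where
  /-- `segment S k i` is the segment for user `k` associated with user `i`. -/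
  segment : Finset (Fin K) → Fin K → Fin K → List (Fin N × Fin T)
  nodup : ∀ S : Finset (Fin K), 2 ≤ S.card → ∀ k ∈ S, ∀ i ∈ S.erase k, (segment S k i).Nodup
  disjoint : ∀ S : Finset (Fin K), 2 ≤ S.card → ∀ k ∈ S, ∀ i ∈ S.erase k, ∀ i' ∈ S.erase k,
    i ≠ i' → (segment S k i).Disjoint (segment S k i')
  cover : ∀ S : Finset (Fin K), 2 ≤ S.card → ∀ k ∈ S, ∀ x : Fin N × Fin T,
    (∃ i ∈ S.erase k, x ∈ segment S k i) ↔ x.1 ∈ exclusive U (S.erase k)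
  even : ∀ S : Finset (Fin K), 2 ≤ S.card → ∀ k ∈ S, ∀ i ∈ S.erase k, ∀ i' ∈ S.erase k,
    (segment S k i).length ≤ (segment S k i').length + 1

/-- The coefficients of the `|S| - 1` linear combinations that the access point forms for each set
`S` of users, one coefficient for each user in `S`, in the field with `2 ^ q` elements. -/
abbrev Coefficients (K q : ℕ) :=
  (S : Finset (Fin K)) → Fin (S.card - 1) → {i : Fin K // i ∈ S} → GaloisField 2 q

/-- The number of bits of an element of the field; this is `q` when `q` is positive. -/
def symbolBits (q : ℕ) : ℕ := Module.finrank (ZMod 2) (GaloisField 2 q)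

/-- A basis over the field with two elements: it identifies symbols with strings of bits. -/
def symbolBasis (q : ℕ) : Module.Basis (Fin (symbolBits q)) (ZMod 2) (GaloisField 2 q) :=
  Module.finBasis (ZMod 2) (GaloisField 2 q)

namespace EvenSplit

variable {K N T : ℕ} {U : Placement K N}

/-- The length of the coded segment that user `i` sends for `S`: the maximal length of the segments
associated with `i` in `S`. -/
def upLength (σ : EvenSplit T U) (S : Finset (Fin K)) (i : Fin K) : ℕ :=
  (S.erase i).sup fun k => (σ.segment S k i).length

/-- Bit `p` of the segment for user `k` associated with user `i` in `S`, padded by zeros, as user `i`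
reads it off its local values. -/
def segmentBit (σ : EvenSplit T U) (S : Finset (Fin K)) (k i : Fin K) (loc : LocalValues T U i)
    (p : ℕ) : ZMod 2 :=
  match (σ.segment S k i)[p]? with
  | none => 0
  | some x => if h : x.1 ∈ U i then loc k ⟨x.1, h⟩ x.2 else 0

/-- The maximal length of the coded segments sent for `S`. -/
def maxUpLength (σ : EvenSplit T U) (S : Finset (Fin K)) : ℕ :=
  S.sup fun i => σ.upLength S i

/-- The number of symbols, in the field with `2 ^ q` elements, needed to hold any of the coded
segments sent for `S`. -/
def symbolCount (σ : EvenSplit T U) (q : ℕ) (S : Finset (Fin K)) : ℕ :=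
  σ.maxUpLength S ⌈/⌉ symbolBits q

/-- Bit positions of the message of user `i`: one coded segment for each set `S ∋ i` of at least two
users. -/
abbrev UpBit (σ : EvenSplit T U) (i : Fin K) : Type :=
  (S : {S : Finset (Fin K) // 2 ≤ S.card ∧ i ∈ S}) × Fin (σ.upLength S.1 i)

/-- Bit positions of the downlink message: `|S| - 1` linear combinations for each set `S` of at
least two users. -/
abbrev DownBit (σ : EvenSplit T U) (q : ℕ) : Type :=
  (S : {S : Finset (Fin K) // 2 ≤ S.card}) ×
    (Fin (S.1.card - 1) × Fin (σ.symbolCount q S.1) × Fin (symbolBits q))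

/-- Symbol number `c` of the coded segment sent by `i` for `S`, padded by zeros. -/
def symbol (σ : EvenSplit T U) (q : ℕ) (W : ∀ i, σ.UpBit i → ZMod 2)
    (S : {S : Finset (Fin K) // 2 ≤ S.card}) (i : {i : Fin K // i ∈ S.1}) (c : ℕ) :
    GaloisField 2 q :=
  ∑ b : Fin (symbolBits q),
    (if h : c * symbolBits q + b < σ.upLength S.1 i.1 then
      W i.1 ⟨⟨S.1, S.2, i.2⟩, ⟨c * symbolBits q + b, h⟩⟩ else 0) • symbolBasis q b

/-- The coded scheme.  For every set `S` of at least two users, each `i ∈ S` sends the sum modulo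
two (XOR) of the zero-padded segments associated with it in `S`, and the access point broadcasts
`|S| - 1` linear combinations, with coefficients `A S`, of these zero-padded coded segments. -/
def scheme (σ : EvenSplit T U) {q : ℕ} (A : Coefficients K q) : ShuffleScheme T U where
  UpBit := σ.UpBit
  DownBit := σ.DownBit q
  upFintype := fun _ => inferInstance
  downFintype := inferInstance
  encode := fun i loc x => ∑ k ∈ x.1.1.erase i, σ.segmentBit x.1.1 k i loc x.2
  relay := fun W x =>
    (symbolBasis q).repr (∑ i : {i : Fin K // i ∈ x.1.1},
      A x.1.1 x.2.1 i * σ.symbol q W x.1 i x.2.2.1) x.2.2.2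

end EvenSplit

/-! ### The randomness -/

instance instMeasurableSpaceGaloisField (q : ℕ) : MeasurableSpace (GaloisField 2 q) := ⊤

/-- The uniformly random placement: the users independently store `m` of the `N` files, uniformly
at random. -/
def placementLaw (K N m : ℕ) : Measure (Placement K N) :=
  Measure.pi fun _ : Fin K => uniformOn {s : Finset (Fin N) | s.card = m}

/-- Independent and uniformly distributed coefficients of the linear combinations. -/
def coefficientLaw (K q : ℕ) : Measure (Coefficients K q) :=
  uniformOn Set.univ

/-- The joint law of the placement and of the coefficients, which are independent. -/
def jointLaw (K N m q : ℕ) : Measure (Placement K N × Coefficients K q) :=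
  (placementLaw K N m).prod (coefficientLaw K q)

end CWDC

end

/-!
The theorem separates into a deterministic and a probabilistic part.

Deterministic part. Fix a set `S` of at least two users. User `k ∈ S` knows its own coded segment
`W_k^S`, and it stores all files that occur in the segments of `S` intended for the other users.
The `|S| - 1` combinations are thus a square linear system for the coded segments of the others, and
if it is nonsingular (`Decodable`), then `k` finds all `W_i^S` and cancels from them everything that
is intended for others; what remains are its own segments (`EvenSplit.scheme_succeeds`).
For the loads, let `x` be the fraction of the files that are stored exclusively by `S \ {k}`. The
splitting is even, so a segment has `x N T / (|S| - 1)` bits up to rounding. If all these fractions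
are close to `μ ^ (|S| - 1) * (1 - μ) ^ (K - |S| + 1)`, then so are, after division by `|S| - 1`,
the normalized lengths of all coded segments, hence summation over `S` gives the loads
(`EvenSplit.abs_uplinkLoad_sub_le`, `EvenSplit.abs_downlinkLoad_sub_le`); padding to whole symbols
costs at most `q = o(N T)` bits per combination. The information loss is the fraction of the files
that are stored exclusively by the empty set of users.

Probabilistic part. The memberships of two different files in a uniformly random set of fixed size
are negatively correlated, and likewise their non-memberships, so the number of files that are
stored exclusively by a given set of users has variance at most `N`, and Chebyshev's inequality
gives concentration (`tendsto_placementLaw_exclusive`). The determinants of the linear systems are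
nonzero polynomials of degree at most `K` in the uniform coefficients, so by the Schwartz-Zippel
lemma each vanishes with probability at most `K / 2 ^ q`, which tends to zero
(`tendsto_coefficientLaw_not_decodable`). Both union bounds run over sets that depend on `K` only.
-/

noncomputable section

namespace CWDC

/-! ### First and second moments of a uniformly random subset -/

/-- The law of a uniformly random set of `m` files. -/
abbrev subsetLaw (N m : ℕ) : Measure (Finset (Fin N)) :=
  uniformOn {s : Finset (Fin N) | s.card = m}

theorem isProbabilityMeasure_subsetLaw {N m : ℕ} (hm : m ≤ N) :
    IsProbabilityMeasure (subsetLaw N m) := by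
  refine isProbabilityMeasure_uniformOn (Set.toFinite _) ?_
  obtain ⟨s, -, hs⟩ := Finset.exists_subset_card_eq
    (s := (Finset.univ : Finset (Fin N))) (n := m) (by simpa using hm)
  exact ⟨s, hs⟩

theorem subsetLaw_real_subset {N m : ℕ} (A : Finset (Fin N)) :
    (subsetLaw N m).real {s | A ⊆ s} =
      ((((Finset.univ : Finset (Fin N)).powersetCard m).filter (A ⊆ ·)).card : ℝ) /
        N.choose m := by
  have h1 : {s : Finset (Fin N) | s.card = m} =
      (((Finset.univ : Finset (Fin N)).powersetCard m : Finset (Finset (Fin N))) : Set _) := by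
    ext s; simp
  have h2 : {s : Finset (Fin N) | A ⊆ s} =
      ((Finset.univ.filter (A ⊆ ·) : Finset (Finset (Fin N))) : Set _) := by
    ext s; simp
  have h3 : (Finset.univ : Finset (Fin N)).powersetCard m ∩ Finset.univ.filter (A ⊆ ·) =
      ((Finset.univ : Finset (Fin N)).powersetCard m).filter (A ⊆ ·) := by
    ext s; simp
  rw [measureReal_def, subsetLaw, h1, h2, uniformOn_apply_finset, h3, ENNReal.toReal_div]
  simp

theorem subsetLaw_real_subset_of_card_le {N m : ℕ} (A : Finset (Fin N)) (hA : A.card ≤ m) :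
    (subsetLaw N m).real {s | A ⊆ s} =
      ((N - A.card).choose (m - A.card) : ℝ) / N.choose m := by
  rw [subsetLaw_real_subset, Finset.card_filter_powersetCard_subset _ _ _ (Finset.subset_univ _) hA,
    Finset.card_univ, Fintype.card_fin]

theorem subsetLaw_real_subset_of_lt_card {N m : ℕ} (A : Finset (Fin N)) (hA : m < A.card) :
    (subsetLaw N m).real {s | A ⊆ s} = 0 := by
  rw [subsetLaw_real_subset, Finset.filter_false_of_mem]
  · simp
  · intro s hs hAs
    have := Finset.card_le_card hAs
    rw [(Finset.mem_powersetCard.1 hs).2] at this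
    omega

theorem subsetLaw_real_singleton {N m : ℕ} (hm : m ≤ N) (n : Fin N) :
    (subsetLaw N m).real {s | {n} ⊆ s} = (m : ℝ) / N := by
  have hN : 0 < N := n.pos
  obtain rfl | hm0 := Nat.eq_zero_or_pos m
  · rw [subsetLaw_real_subset_of_lt_card _ (by simp)]; simp
  rw [subsetLaw_real_subset_of_card_le _ (by rwa [Finset.card_singleton]), Finset.card_singleton]
  obtain ⟨k, rfl⟩ : ∃ k, m = k + 1 := ⟨m - 1, by omega⟩
  obtain ⟨l, rfl⟩ : ∃ l, N = l + 1 := ⟨N - 1, by omega⟩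
  have h := Nat.add_one_mul_choose_eq l k
  have hc : 0 < (l + 1).choose (k + 1) := Nat.choose_pos hm
  rw [div_eq_div_iff (by exact_mod_cast hc.ne') (by positivity)]
  simp only [Nat.add_sub_cancel]
  have h' : ((l + 1 : ℕ) : ℝ) * l.choose k = (l + 1).choose (k + 1) * (k + 1 : ℕ) := by
    exact_mod_cast h
  linarith

/-- The events that two different files belong to a uniformly random set of fixed size are
negatively correlated. -/
theorem subsetLaw_real_pair_le {N m : ℕ} (hm : m ≤ N) {n n' : Fin N} (hn : n ≠ n') :
    (subsetLaw N m).real {s | {n, n'} ⊆ s} ≤ ((m : ℝ) / N) ^ 2 := by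
  have hcard : ({n, n'} : Finset (Fin N)).card = 2 := Finset.card_pair hn
  obtain hm2 | hm2 := lt_or_ge m 2
  · rw [subsetLaw_real_subset_of_lt_card _ (by omega)]; positivity
  rw [subsetLaw_real_subset_of_card_le _ (by omega), hcard]
  obtain ⟨k, rfl⟩ : ∃ k, m = k + 2 := ⟨m - 2, by omega⟩
  obtain ⟨l, rfl⟩ : ∃ l, N = l + 2 := ⟨N - 2, by omega⟩
  have h1 : ((l : ℝ) + 1) * l.choose k = (l + 1).choose (k + 1) * (k + 1) := by
    exact_mod_cast Nat.add_one_mul_choose_eq l k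
  have h2 : ((l : ℝ) + 2) * (l + 1).choose (k + 1) = (l + 2).choose (k + 2) * (k + 2) := by
    exact_mod_cast Nat.add_one_mul_choose_eq (l + 1) (k + 1)
  have hc : (0 : ℝ) < (l + 2).choose (k + 2) := by exact_mod_cast Nat.choose_pos hm
  have hkl : (k : ℝ) ≤ l := by exact_mod_cast (by omega : k ≤ l)
  have h3 : (l.choose k : ℝ) / (l + 2).choose (k + 2) =
      ((k + 1) / (l + 1)) * ((k + 2) / (l + 2)) := by
    field_simp
    linear_combination ((l : ℝ) + 2) * h1 + ((k : ℝ) + 1) * h2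
  simp only [Nat.add_sub_cancel]
  rw [h3, sq]
  push_cast
  gcongr ?_ * _
  rw [div_le_div_iff₀ (by positivity) (by positivity)]
  nlinarith

/-- The indicator of `n ∈ s` if `i ∈ W`, and of `n ∉ s` otherwise. -/
def membershipIndicator {K N : ℕ} (W : Finset (Fin K)) (i : Fin K) (n : Fin N)
    (s : Finset (Fin N)) : ℝ :=
  if (n ∈ s ↔ i ∈ W) then 1 else 0

/-- The mean of `membershipIndicator` when a set contains a file with probability `a`. -/
def membershipMean {K : ℕ} (W : Finset (Fin K)) (a : ℝ) (i : Fin K) : ℝ :=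
  if i ∈ W then a else 1 - a

theorem membershipMean_nonneg {K : ℕ} {W : Finset (Fin K)} {a : ℝ} (h0 : 0 ≤ a) (h1 : a ≤ 1)
    (i : Fin K) : 0 ≤ membershipMean W a i := by
  unfold membershipMean; split_ifs <;> linarith

theorem membershipMean_le_one {K : ℕ} {W : Finset (Fin K)} {a : ℝ} (h0 : 0 ≤ a) (h1 : a ≤ 1)
    (i : Fin K) : membershipMean W a i ≤ 1 := by
  unfold membershipMean; split_ifs <;> linarith

theorem integral_ite_subset {N m : ℕ} (A : Finset (Fin N)) :
    ∫ s, (if A ⊆ s then (1 : ℝ) else 0) ∂(subsetLaw N m) =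
      (subsetLaw N m).real {s | A ⊆ s} := by
  rw [← integral_indicator_one (Set.toFinite _).measurableSet]
  congr 1
  funext s
  by_cases hs : A ⊆ s <;> simp [hs]

theorem integral_membershipIndicator {K N m : ℕ} (hm : m ≤ N) (W : Finset (Fin K)) (i : Fin K)
    (n : Fin N) :
    ∫ s, membershipIndicator W i n s ∂(subsetLaw N m) = membershipMean W ((m : ℝ) / N) i := by
  have := isProbabilityMeasure_subsetLaw hm
  have h := (integral_ite_subset (m := m) {n}).trans (subsetLaw_real_singleton hm n)
  by_cases hi : i ∈ W
  · simpa [membershipIndicator, membershipMean, hi] using h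
  · have h' : ∀ s, membershipIndicator W i n s = 1 - (if {n} ⊆ s then (1 : ℝ) else 0) := by
      intro s
      by_cases hs : n ∈ s <;> simp [membershipIndicator, hi, hs]
    simp_rw [h', membershipMean, if_neg hi]
    rw [integral_sub (by simp) .of_finite, h]
    simp

theorem integral_membershipIndicator_mul_le {K N m : ℕ} (hm : m ≤ N) (W : Finset (Fin K))
    (i : Fin K) {n n' : Fin N} (hn : n ≠ n') :
    ∫ s, membershipIndicator W i n s * membershipIndicator W i n' s ∂(subsetLaw N m) ≤
      membershipMean W ((m : ℝ) / N) i ^ 2 := by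
  have := isProbabilityMeasure_subsetLaw hm
  have h := (integral_ite_subset (m := m) {n}).trans (subsetLaw_real_singleton hm n)
  have h' := (integral_ite_subset (m := m) {n'}).trans (subsetLaw_real_singleton hm n')
  have h2 := (integral_ite_subset (m := m) {n, n'}).trans_le (subsetLaw_real_pair_le hm hn)
  by_cases hi : i ∈ W
  · have e : ∀ s, membershipIndicator W i n s * membershipIndicator W i n' s =
        if {n, n'} ⊆ s then (1 : ℝ) else 0 := by
      intro s
      by_cases hs : n ∈ s <;> by_cases hs' : n' ∈ s <;>
        simp [membershipIndicator, hi, hs, hs', Finset.insert_subset_iff]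
    simpa only [e, membershipMean, if_pos hi] using h2
  · have e : ∀ s, membershipIndicator W i n s * membershipIndicator W i n' s =
        ((1 - (if {n} ⊆ s then (1 : ℝ) else 0)) - if {n'} ⊆ s then (1 : ℝ) else 0) +
          if {n, n'} ⊆ s then (1 : ℝ) else 0 := by
      intro s
      by_cases hs : n ∈ s <;> by_cases hs' : n' ∈ s <;>
        simp [membershipIndicator, hi, hs, hs', Finset.insert_subset_iff]
    simp_rw [e, membershipMean, if_neg hi]
    rw [integral_add .of_finite .of_finite, integral_sub .of_finite .of_finite,
      integral_sub (by simp) .of_finite, h, h']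
    simp only [integral_const, probReal_univ, smul_eq_mul, mul_one]
    linarith

/-! ### Concentration of the numbers of exclusively stored files -/

theorem isProbabilityMeasure_placementLaw {K N m : ℕ} (hm : m ≤ N) :
    IsProbabilityMeasure (placementLaw K N m) := by
  have := isProbabilityMeasure_subsetLaw hm
  unfold placementLaw
  infer_instance

theorem card_exclusive_eq_sum {K N : ℕ} (W : Finset (Fin K)) (U : Placement K N) :
    ((exclusive U W).card : ℝ) = ∑ n, ∏ i, membershipIndicator W i n (U i) := by
  rw [exclusive, Finset.card_filter]
  push_cast
  refine Finset.sum_congr rfl fun n _ => ?_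
  simp only [membershipIndicator, Finset.prod_ite_zero, Finset.prod_const_one]
  congr 1
  apply propext
  constructor
  · rintro ⟨h1, h2⟩ i -
    by_cases hi : i ∈ W
    · exact iff_of_true (h1 i hi) hi
    · exact iff_of_false (h2 i hi) hi
  · exact fun h => ⟨fun i hi => (h i (Finset.mem_univ i)).2 hi,
      fun i hi hn => hi ((h i (Finset.mem_univ i)).1 hn)⟩

/-- The asymptotic fraction of the files that are stored exclusively by the users in `W`, when
every user stores every file with probability `a`. -/
def exclusiveProb {K : ℕ} (W : Finset (Fin K)) (a : ℝ) : ℝ := a ^ W.card * (1 - a) ^ (K - W.card)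

theorem prod_membershipMean {K : ℕ} (W : Finset (Fin K)) (a : ℝ) :
    ∏ i, membershipMean W a i = exclusiveProb W a := by
  simp only [membershipMean, exclusiveProb]
  rw [Finset.prod_ite, Finset.prod_const, Finset.prod_const]
  congr 2
  · simp
  · rw [Finset.filter_not, Finset.card_sdiff_of_subset (Finset.filter_subset _ _)]; simp

/-- Since the indicators of different files are negatively correlated, the variance of the number
of files stored exclusively by the users in `W` is at most the number of files. -/
theorem integral_card_exclusive_sub_sq_le {K N m : ℕ} (hm : m ≤ N) (W : Finset (Fin K)) :
    ∫ U, ((exclusive U W).card - N * exclusiveProb W ((m : ℝ) / N)) ^ 2 ∂(placementLaw K N m) ≤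
      N := by
  have := isProbabilityMeasure_subsetLaw hm
  have := isProbabilityMeasure_placementLaw (K := K) hm
  set a : ℝ := (m : ℝ) / N
  have ha0 : 0 ≤ a := by positivity
  have ha1 : a ≤ 1 := div_le_one_of_le₀ (by exact_mod_cast hm) (by positivity)
  set P : ℝ := exclusiveProb W a with hP
  have hP0 : 0 ≤ P := by
    rw [hP, ← prod_membershipMean]
    exact Finset.prod_nonneg fun i _ => membershipMean_nonneg ha0 ha1 i
  have hP1 : P ≤ 1 := by
    rw [hP, ← prod_membershipMean]
    exact Finset.prod_le_one (fun i _ => membershipMean_nonneg ha0 ha1 i)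
      fun i _ => membershipMean_le_one ha0 ha1 i
  let I : Fin N → Placement K N → ℝ := fun n U => ∏ i, membershipIndicator W i n (U i)
  have hI1 : ∀ n, ∫ U, I n U ∂(placementLaw K N m) = P := by
    intro n
    simp only [I, placementLaw]
    rw [integral_fintype_prod_eq_prod (fun i s => membershipIndicator W i n s), hP,
      ← prod_membershipMean]
    exact Finset.prod_congr rfl fun i _ => integral_membershipIndicator hm W i n
  have hI2 : ∀ n n', ∫ U, I n U * I n' U ∂(placementLaw K N m) ≤
      P ^ 2 + if n = n' then 1 else 0 := by
    intro n n'
    split_ifs with hn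
    · -- the diagonal terms add up to at most `N`, so the trivial bound suffices
      subst hn
      have : ∀ U, I n U * I n U ≤ 1 := by
        intro U
        have h0 : 0 ≤ I n U := Finset.prod_nonneg fun i _ => by
          unfold membershipIndicator; split_ifs <;> norm_num
        have h1 : I n U ≤ 1 := Finset.prod_le_one
          (fun i _ => by unfold membershipIndicator; split_ifs <;> norm_num)
          (fun i _ => by unfold membershipIndicator; split_ifs <;> norm_num)
        nlinarith
      calc _ ≤ ∫ U, (1 : ℝ) ∂(placementLaw K N m) :=
            integral_mono .of_finite .of_finite this
        _ ≤ _ := by simp; positivity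
    · simp only [I, placementLaw, ← Finset.prod_mul_distrib]
      rw [integral_fintype_prod_eq_prod
        (fun i s => membershipIndicator W i n s * membershipIndicator W i n' s), hP,
        ← prod_membershipMean, ← Finset.prod_pow, add_zero]
      refine Finset.prod_le_prod (fun i _ => integral_nonneg fun s => ?_)
        fun i _ => integral_membershipIndicator_mul_le hm W i hn
      simp only [membershipIndicator]
      split_ifs <;> simp
  have hexp : ∀ U : Placement K N, (((exclusive U W).card : ℝ) - N * P) ^ 2 =
      (∑ n, ∑ n', I n U * I n' U) - 2 * (N * P) * ∑ n, I n U + (N * P) ^ 2 := by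
    intro U
    rw [card_exclusive_eq_sum, ← Finset.sum_mul_sum]
    ring
  simp_rw [hexp]
  rw [integral_add .of_finite .of_finite, integral_sub .of_finite .of_finite,
    integral_const_mul, integral_finsetSum _ fun _ _ => .of_finite,
    integral_finsetSum _ fun _ _ => .of_finite]
  simp_rw [hI1]
  have hle : ∑ n, ∫ U, ∑ n', I n U * I n' U ∂(placementLaw K N m) ≤ N * (N * P ^ 2) + N := by
    calc _ = ∑ n, ∑ n', ∫ U, I n U * I n' U ∂(placementLaw K N m) := by
          refine Finset.sum_congr rfl fun n _ => ?_
          rw [integral_finsetSum _ fun _ _ => .of_finite]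
      _ ≤ ∑ n : Fin N, ∑ n' : Fin N, (P ^ 2 + if n = n' then 1 else 0) :=
          Finset.sum_le_sum fun n _ => Finset.sum_le_sum fun n' _ => hI2 n n'
      _ = _ := by simp [Finset.sum_add_distrib]
  simp only [integral_const, probReal_univ, smul_eq_mul, one_mul, Finset.sum_const,
    Finset.card_univ, Fintype.card_fin, nsmul_eq_mul]
  nlinarith

/-- Chebyshev's inequality for the number of files stored exclusively by the users in `W`. -/
theorem placementLaw_real_deviation_le {K N m : ℕ} (hN : 0 < N) (hm : m ≤ N)
    (W : Finset (Fin K)) {δ : ℝ} (hδ : 0 < δ) :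
    (placementLaw K N m).real
      {U | δ ≤ |((exclusive U W).card : ℝ) / N - exclusiveProb W ((m : ℝ) / N)|} ≤
      1 / (N * δ ^ 2) := by
  have := isProbabilityMeasure_placementLaw (K := K) hm
  have hN' : (0 : ℝ) < N := by exact_mod_cast hN
  have h := mul_meas_ge_le_integral_of_nonneg (μ := placementLaw K N m)
    (f := fun U => (((exclusive U W).card : ℝ) - N * exclusiveProb W ((m : ℝ) / N)) ^ 2)
    (Eventually.of_forall fun U => sq_nonneg _) .of_finite ((N * δ) ^ 2)
  have hsub : {U : Placement K N |
        δ ≤ |((exclusive U W).card : ℝ) / N - exclusiveProb W ((m : ℝ) / N)|} ⊆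
      {U | (N * δ) ^ 2 ≤
        (((exclusive U W).card : ℝ) - N * exclusiveProb W ((m : ℝ) / N)) ^ 2} := by
    intro U hU
    simp only [Set.mem_ofPred_eq] at hU ⊢
    have e : ((exclusive U W).card : ℝ) - N * exclusiveProb W ((m : ℝ) / N) =
        N * (((exclusive U W).card : ℝ) / N - exclusiveProb W ((m : ℝ) / N)) := by
      field_simp
    rw [e, mul_pow, mul_pow, ← sq_abs (_ / _ - _)]
    gcongr
  have hle := (mul_le_mul_of_nonneg_left (measureReal_mono (μ := placementLaw K N m) hsub)
    (sq_nonneg (N * δ))).trans (h.trans (integral_card_exclusive_sub_sq_le hm W))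
  rw [le_div_iff₀ (by positivity)]
  have : N * ((placementLaw K N m).real {U | δ ≤ |((exclusive U W).card : ℝ) / N -
      exclusiveProb W ((m : ℝ) / N)|} * (N * δ ^ 2)) ≤ N * 1 := by
    linarith
  exact le_of_mul_le_mul_left this hN'

/-- If the sizes of the random sets are asymptotic to `μ * N`, then with high probability all
numbers of exclusively stored files, normalized by `N`, are close to their limits. -/
theorem tendsto_placementLaw_exclusive (K : ℕ) {μ : ℝ} (m : ℕ → ℕ) (hm : ∀ N, m N ≤ N)
    (hμ : Tendsto (fun N => (m N : ℝ) / N) atTop (𝓝 μ)) {δ : ℝ} (hδ : 0 < δ) :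
    Tendsto (fun N => (placementLaw K N (m N)).real
      {U | ∃ W : Finset (Fin K), δ ≤ |((exclusive U W).card : ℝ) / N - exclusiveProb W μ|})
      atTop (𝓝 0) := by
  have hev : ∀ᶠ N in atTop, ∀ W : Finset (Fin K),
      |exclusiveProb W ((m N : ℝ) / N) - exclusiveProb W μ| < δ / 2 := by
    rw [eventually_all]
    intro W
    have hc : Continuous (exclusiveProb W) := by unfold exclusiveProb; fun_prop
    have := (hc.tendsto μ).comp hμ
    exact (Metric.tendsto_nhds.1 this) (δ / 2) (by positivity)
  have hbound : ∀ᶠ N : ℕ in atTop, (placementLaw K N (m N)).real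
      {U | ∃ W : Finset (Fin K), δ ≤ |((exclusive U W).card : ℝ) / N - exclusiveProb W μ|} ≤
        (Fintype.card (Finset (Fin K)) / (δ / 2) ^ 2) * ((N : ℝ))⁻¹ := by
    filter_upwards [hev, eventually_gt_atTop 0] with N hN hN0
    have := isProbabilityMeasure_placementLaw (K := K) (hm N)
    have hsub : {U : Placement K N | ∃ W : Finset (Fin K),
          δ ≤ |((exclusive U W).card : ℝ) / N - exclusiveProb W μ|} ⊆
        ⋃ W : Finset (Fin K), {U | δ / 2 ≤
          |((exclusive U W).card : ℝ) / N - exclusiveProb W ((m N : ℝ) / N)|} := by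
      rintro U ⟨W, hW⟩
      refine Set.mem_iUnion.2 ⟨W, ?_⟩
      have h1 := hN W
      have h2 := abs_sub_le (((exclusive U W).card : ℝ) / N) (exclusiveProb W ((m N : ℝ) / N))
        (exclusiveProb W μ)
      simp only [Set.mem_ofPred_eq]
      linarith
    calc _ ≤ _ := measureReal_mono hsub
      _ ≤ _ := measureReal_iUnion_fintype_le _
      _ ≤ ∑ W : Finset (Fin K), 1 / (N * (δ / 2) ^ 2) := Finset.sum_le_sum fun W _ =>
          placementLaw_real_deviation_le hN0 (hm N) W (by positivity)
      _ = _ := by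
          rw [Finset.sum_const, Finset.card_univ, nsmul_eq_mul]
          field_simp
  refine tendsto_of_tendsto_of_tendsto_of_le_of_le' tendsto_const_nhds ?_
    (Eventually.of_forall fun N => measureReal_nonneg) hbound
  simpa using (tendsto_inv_atTop_nhds_zero_nat (𝕜 := ℝ)).const_mul
    (Fintype.card (Finset (Fin K)) / (δ / 2) ^ 2)

/-! ### Solvability of random linear systems -/

/-- The **Schwartz-Zippel lemma** over a finite field, with variables indexed by a finite type. -/
theorem natCard_zeros_le {ι F : Type*} [Finite ι] [Field F] [Finite F] (p : MvPolynomial ι F)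
    (hp : p ≠ 0) :
    (Nat.card {x : ι → F // MvPolynomial.eval x p = 0} : ℝ) ≤
      p.totalDegree / Nat.card F * Nat.card (ι → F) := by
  classical
  have := Fintype.ofFinite ι
  have := Fintype.ofFinite F
  let e := Fintype.equivFin ι
  have hp' : MvPolynomial.rename e p ≠ 0 := by
    rwa [Ne, ← map_zero (MvPolynomial.rename e),
      (MvPolynomial.rename_injective e e.injective).eq_iff]
  have h := MvPolynomial.schwartz_zippel_totalDegree hp' (Finset.univ : Finset F)
  have hcard : ({f ∈ Fintype.piFinset fun _ : Fin (Fintype.card ι) => (Finset.univ : Finset F) |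
      MvPolynomial.eval f (MvPolynomial.rename e p) = 0}).card =
      Nat.card {x : ι → F // MvPolynomial.eval x p = 0} := by
    rw [Fintype.piFinset_univ, ← Fintype.card_subtype, Nat.card_eq_fintype_card]
    refine Fintype.card_congr ((Equiv.arrowCongr e.symm (Equiv.refl F)).subtypeEquiv fun f => ?_)
    rw [MvPolynomial.eval_rename]
    rfl
  rw [hcard] at h
  have h' : (Nat.card {x : ι → F // MvPolynomial.eval x p = 0} : ℝ) /
      (Fintype.card F : ℝ) ^ Fintype.card ι ≤ (MvPolynomial.rename e p).totalDegree /
        Fintype.card F := by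
    simpa [Finset.card_univ] using (NNRat.cast_le (K := ℝ)).2 h
  rw [Nat.card_fun, Nat.card_eq_fintype_card (α := F), Nat.card_eq_fintype_card (α := ι)]
  rw [div_le_iff₀ (by have := Fintype.card_pos (α := F); positivity)] at h'
  push_cast
  refine h'.trans ?_
  gcongr
  exact MvPolynomial.totalDegree_rename_le _ _

/-- The determinant of a matrix of distinct variables is a nonzero polynomial. -/
theorem det_X_ne_zero {n ι F : Type*} [Fintype n] [DecidableEq n] [Field F] (g : n → n → ι)
    (hg : Function.Injective fun x : n × n => g x.1 x.2) :
    (Matrix.of fun a b => (MvPolynomial.X (g a b) : MvPolynomial ι F)).det ≠ 0 := by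
  have h : MvPolynomial.rename (fun x : n × n => g x.1 x.2) (Matrix.mvPolynomialX n n F).det =
      (Matrix.of fun a b => (MvPolynomial.X (g a b) : MvPolynomial ι F)).det := by
    rw [AlgHom.map_det]
    congr 1
    ext1 a b
    simp [Matrix.mvPolynomialX]
  rw [← h, Ne, ← map_zero (MvPolynomial.rename (fun x : n × n => g x.1 x.2)),
    (MvPolynomial.rename_injective _ hg).eq_iff]
  exact Matrix.det_mvPolynomialX_ne_zero n F

theorem totalDegree_det_X_le {n ι F : Type*} [Fintype n] [DecidableEq n] [Field F]
    (g : n → n → ι) :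
    (Matrix.of fun a b => (MvPolynomial.X (g a b) : MvPolynomial ι F)).det.totalDegree ≤
      Fintype.card n := by
  rw [Matrix.det_apply]
  refine MvPolynomial.totalDegree_finsetSum_le fun s _ => ?_
  refine (MvPolynomial.totalDegree_smul_le _ _).trans ?_
  refine (MvPolynomial.totalDegree_finsetProd _ _).trans ?_
  simp

/-- The coefficients allow every user to recover, for each set `S` of at least two users that
contains it, all symbols of the other users in `S` from its own symbol and the `|S| - 1` linear
combinations: a vector that vanishes at the position of the user and is annihilated by all linear
combinations is zero. -/
def Decodable {K q : ℕ} (A : Coefficients K q) : Prop :=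
  ∀ S : Finset (Fin K), 2 ≤ S.card → ∀ k : {i : Fin K // i ∈ S},
    ∀ x : {i : Fin K // i ∈ S} → GaloisField 2 q, x k = 0 →
      (∀ r, ∑ i, A S r i * x i = 0) → x = 0

/-- The users of `S` other than `k`, numbered by the linear combinations formed for `S`. -/
def othersEquiv {K : ℕ} (S : Finset (Fin K)) (k : {i : Fin K // i ∈ S}) :
    Fin (S.card - 1) ≃ {i : {i : Fin K // i ∈ S} // i ≠ k} :=
  (Fintype.equivFinOfCardEq (by simp [Fintype.card_subtype_compl])).symm

/-- Decodability at user `k` of the set `S` follows from the nonsingularity of the square matrix of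
the coefficients of the other users. -/
theorem eq_zero_of_det_ne_zero {K q : ℕ} {A : Coefficients K q} {S : Finset (Fin K)}
    {k : {i : Fin K // i ∈ S}}
    (hdet : (Matrix.of fun r r' => A S r (othersEquiv S k r').1).det ≠ 0)
    {x : {i : Fin K // i ∈ S} → GaloisField 2 q} (hk : x k = 0)
    (hx : ∀ r, ∑ i, A S r i * x i = 0) : x = 0 := by
  have h0 : (fun r' => x (othersEquiv S k r').1) = 0 := by
    refine Matrix.eq_zero_of_mulVec_eq_zero hdet ?_
    funext r
    have h := hx r
    rw [← Finset.add_sum_erase _ _ (Finset.mem_univ k), hk, mul_zero, zero_add] at h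
    simp only [Matrix.mulVec, dotProduct, Matrix.of_apply, Pi.zero_apply]
    rw [Equiv.sum_comp (othersEquiv S k) (fun i => A S r i.1 * x i.1), ← h]
    refine (Finset.sum_subtype _ (fun i => ?_) fun i => A S r i * x i).symm
    simp
  funext i
  by_cases hi : i = k
  · rw [hi, hk]; rfl
  · simpa using congrFun h0 ((othersEquiv S k).symm ⟨i, hi⟩)

instance isProbabilityMeasure_coefficientLaw (K q : ℕ) :
    IsProbabilityMeasure (coefficientLaw K q) :=
  isProbabilityMeasure_uniformOn Set.finite_univ Set.univ_nonempty

theorem coefficientLaw_real_det_eq_zero_le {K q : ℕ} (hq : q ≠ 0) (S : Finset (Fin K))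
    (k : {i : Fin K // i ∈ S}) :
    (coefficientLaw K q).real
      {A | (Matrix.of fun r r' => A S r (othersEquiv S k r').1).det = 0} ≤ K / 2 ^ q := by
  classical
  have := Fintype.ofFinite (Coefficients K q)
  let ι := (S : Finset (Fin K)) × Fin (S.card - 1) × {i : Fin K // i ∈ S}
  let e : Coefficients K q ≃ (ι → GaloisField 2 q) :=
    { toFun := fun A x => A x.1 x.2.1 x.2.2
      invFun := fun f S r i => f ⟨S, r, i⟩
      left_inv := fun _ => rfl
      right_inv := fun _ => rfl }
  let g : Fin (S.card - 1) → Fin (S.card - 1) → ι := fun r r' => ⟨S, r, (othersEquiv S k r').1⟩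
  have hg : Function.Injective fun x : Fin (S.card - 1) × Fin (S.card - 1) => g x.1 x.2 := by
    rintro ⟨r, r'⟩ ⟨s, s'⟩ h
    have h' := Prod.mk.inj (eq_of_heq (Sigma.mk.inj_iff.1 h).2)
    exact Prod.ext h'.1 ((othersEquiv S k).injective (Subtype.ext h'.2))
  let p : MvPolynomial ι (GaloisField 2 q) := (Matrix.of fun a b => MvPolynomial.X (g a b)).det
  have hp := natCard_zeros_le p (det_X_ne_zero g hg)
  have heval : ∀ A : Coefficients K q, MvPolynomial.eval (e A) p =
      (Matrix.of fun r r' => A S r (othersEquiv S k r').1).det := by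
    intro A
    simp only [p, RingHom.map_det]
    congr 1
    ext1 a b
    simp [g, e]
  have hdeg : (p.totalDegree : ℝ) ≤ K := by
    have h1 := totalDegree_det_X_le (F := GaloisField 2 q) g
    have h2 := Finset.card_le_univ S
    simp only [Fintype.card_fin] at h1 h2
    exact_mod_cast h1.trans (by omega)
  have hcard : Nat.card {A : Coefficients K q //
        (Matrix.of fun r r' => A S r (othersEquiv S k r').1).det = 0} =
      Nat.card {x : ι → GaloisField 2 q // MvPolynomial.eval x p = 0} :=
    Nat.card_congr (e.subtypeEquiv fun A => by rw [heval])
  have hF : Nat.card (GaloisField 2 q) = 2 ^ q := GaloisField.card 2 q hq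
  have hpos : (0 : ℝ) < Nat.card (Coefficients K q) := by exact_mod_cast Nat.card_pos
  rw [← Nat.card_congr e, ← hcard, hF] at hp
  rw [measureReal_def, coefficientLaw, uniformOn_univ, ENNReal.toReal_div,
    Measure.count_apply_finite _ (Set.toFinite _), ← Nat.card_eq_card_finite_toFinset,
    ← Nat.card_eq_fintype_card]
  simp only [ENNReal.toReal_natCast]
  rw [div_le_iff₀ hpos]
  refine hp.trans ?_
  push_cast
  gcongr

/-- Random coefficients in a large field are decodable with high probability. -/
theorem tendsto_coefficientLaw_not_decodable (K : ℕ) {q : ℕ → ℕ} (hq : Tendsto q atTop atTop) :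
    Tendsto (fun N => (coefficientLaw K (q N)).real {A | ¬ Decodable A}) atTop (𝓝 0) := by
  have hbound : ∀ᶠ N in atTop, (coefficientLaw K (q N)).real {A | ¬ Decodable A} ≤
      (Fintype.card ((S : Finset (Fin K)) × {i : Fin K // i ∈ S}) * K) * ((1 / 2 : ℝ)) ^ q N := by
    filter_upwards [hq.eventually_gt_atTop 0] with N hN
    have hsub : {A : Coefficients K (q N) | ¬ Decodable A} ⊆
        ⋃ x : (S : Finset (Fin K)) × {i : Fin K // i ∈ S},
          {A | (Matrix.of fun r r' => A x.1 r (othersEquiv x.1 x.2 r').1).det = 0} := by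
      intro A hA
      by_contra hcon
      simp only [Set.mem_iUnion, Set.mem_ofPred_eq, not_exists] at hcon
      exact hA fun S _ k x hk hx => eq_zero_of_det_ne_zero (hcon ⟨S, k⟩) hk hx
    calc _ ≤ _ := measureReal_mono hsub
      _ ≤ _ := measureReal_iUnion_fintype_le _
      _ ≤ ∑ x : (S : Finset (Fin K)) × {i : Fin K // i ∈ S}, (K : ℝ) / 2 ^ q N :=
          Finset.sum_le_sum fun x _ => coefficientLaw_real_det_eq_zero_le hN.ne' x.1 x.2
      _ = _ := by
          rw [Finset.sum_const, Finset.card_univ, nsmul_eq_mul, one_div, inv_pow]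
          ring
  refine tendsto_of_tendsto_of_tendsto_of_le_of_le' tendsto_const_nhds ?_
    (Eventually.of_forall fun N => measureReal_nonneg) hbound
  simpa using ((tendsto_pow_atTop_nhds_zero_of_lt_one (by norm_num : (0 : ℝ) ≤ 1 / 2)
    (by norm_num)).comp hq).const_mul
      ((Fintype.card ((S : Finset (Fin K)) × {i : Fin K // i ∈ S}) * K : ℝ))

/-! ### Decoding -/

/-- A Shuffle phase succeeds if the downlink message and the local values of a user determine the
values that it needs. -/
theorem ShuffleScheme.succeeds_of_injective {K N T : ℕ} {U : Placement K N}
    (s : ShuffleScheme T U)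
    (h : ∀ k (v v' : Values K N T), s.downlinkMessage v = s.downlinkMessage v' →
      localValues U k v = localValues U k v' → ∀ n ∈ available U, v k n = v' k n) :
    s.Succeeds := by
  classical
  intro k
  refine ⟨fun d l n => if hv : ∃ v, s.downlinkMessage v = d ∧ localValues U k v = l then
    hv.choose k n.1 else 0, fun v n => ?_⟩
  have hv : ∃ v', s.downlinkMessage v' = s.downlinkMessage v ∧
    localValues U k v' = localValues U k v := ⟨v, rfl, rfl⟩
  simp only [dif_pos hv]
  exact h k _ _ hv.choose_spec.1 hv.choose_spec.2 n.1 n.2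

theorem symbolBits_eq {q : ℕ} (hq : q ≠ 0) : symbolBits q = q := GaloisField.finrank 2 hq

namespace EvenSplit

variable {K N T : ℕ} {U : Placement K N}

/-- The uplink messages when the intermediate values are `v`. -/
def uplink (σ : EvenSplit T U) (v : Values K N T) (i : Fin K) : σ.UpBit i → ZMod 2 :=
  fun x => ∑ k ∈ x.1.1.erase i, σ.segmentBit x.1.1 k i (localValues U i v) x.2

/-- A user of `S` knows all segments in `S` that are intended for other users. -/
theorem segmentBit_congr (σ : EvenSplit T U) {S : Finset (Fin K)} (hS : 2 ≤ S.card)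
    {i j k : Fin K} (hi : i ∈ S) (hj : j ∈ S.erase i) (hk : k ∈ S) (hkj : k ≠ j)
    {v v' : Values K N T} (h : localValues U k v = localValues U k v') (p : ℕ) :
    σ.segmentBit S j i (localValues U i v) p = σ.segmentBit S j i (localValues U i v') p := by
  unfold segmentBit
  have hjS := Finset.mem_of_mem_erase hj
  have hij : i ∈ S.erase j := Finset.mem_erase.2 ⟨(Finset.ne_of_mem_erase hj).symm, hi⟩
  rcases hx : (σ.segment S j i)[p]? with _ | x
  · rfl
  · have hmem := (σ.cover S hS j hjS x).1 ⟨i, hij, List.mem_of_getElem? hx⟩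
    have hxk : x.1 ∈ U k :=
      (Finset.mem_filter.1 hmem).2.1 k (Finset.mem_erase.2 ⟨hkj, hk⟩)
    have hv : v j x.1 = v' j x.1 := congrFun (congrFun h j) ⟨x.1, hxk⟩
    simp only [localValues, hv]

theorem uplink_congr (σ : EvenSplit T U) {k : Fin K} {v v' : Values K N T}
    (h : localValues U k v = localValues U k v') : σ.uplink v k = σ.uplink v' k := by
  funext x
  simp only [uplink, h]

/-- The symbols of a coded segment determine its bits. -/
theorem uplink_eq_of_symbol_eq (σ : EvenSplit T U) {q : ℕ} (hq : q ≠ 0)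
    (W W' : ∀ i, σ.UpBit i → ZMod 2) (S : {S : Finset (Fin K) // 2 ≤ S.card})
    (i : {i : Fin K // i ∈ S.1})
    (h : ∀ c < σ.symbolCount q S.1, σ.symbol q W S i c = σ.symbol q W' S i c)
    (p : Fin (σ.upLength S.1 i.1)) :
    W i.1 ⟨⟨S.1, S.2, i.2⟩, p⟩ = W' i.1 ⟨⟨S.1, S.2, i.2⟩, p⟩ := by
  have hB : 0 < symbolBits q := by rw [symbolBits_eq hq]; omega
  have hp : (p : ℕ) < σ.symbolCount q S.1 * symbolBits q := by
    have h1 : σ.upLength S.1 i.1 ≤ σ.maxUpLength S.1 := Finset.le_sup (f := σ.upLength S.1) i.2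
    have h2 : σ.maxUpLength S.1 ≤ symbolBits q • σ.symbolCount q S.1 := le_smul_ceilDiv hB
    rw [smul_eq_mul, mul_comm] at h2
    omega
  have hc := h ((p : ℕ) / symbolBits q) (Nat.div_lt_of_lt_mul (by rwa [mul_comm] at hp))
  have hb := congrFun (congrArg (fun z => ((symbolBasis q).repr z : Fin (symbolBits q) → ZMod 2)) hc)
    ⟨(p : ℕ) % symbolBits q, Nat.mod_lt _ hB⟩
  have hpe : (p : ℕ) / symbolBits q * symbolBits q + (p : ℕ) % symbolBits q = p := by
    rw [mul_comm]; exact Nat.div_add_mod _ _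
  simp only [symbol, Module.Basis.repr_sum_self] at hb
  simp only [hpe, p.2, dite_true] at hb
  exact hb

/-- The coded scheme succeeds as soon as the coefficients are decodable: a user knows its own
coded segment for `S`, hence recovers those of the other users from the linear combinations, and
cancels the segments that are intended for others. -/
theorem scheme_succeeds (σ : EvenSplit T U) {q : ℕ} (hq : q ≠ 0) {A : Coefficients K q}
    (hA : Decodable A) : (σ.scheme A).Succeeds := by
  classical
  refine ShuffleScheme.succeeds_of_injective _ fun k v v' hd hl n hn => ?_
  by_cases hnk : n ∈ U k
  · exact congrFun (congrFun hl k) ⟨n, hnk⟩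
  let W : Finset (Fin K) := Finset.univ.filter fun i => n ∈ U i
  have hkW : k ∉ W := by simp [W, hnk]
  obtain ⟨k', hk'⟩ : W.Nonempty := by
    obtain ⟨k', hk'⟩ := (Finset.mem_filter.1 hn).2
    exact ⟨k', by simp [W, hk']⟩
  let S : Finset (Fin K) := insert k W
  have hkS : k ∈ S := Finset.mem_insert_self _ _
  have hSe : S.erase k = W := Finset.erase_insert hkW
  have hS : 2 ≤ S.card := by
    rw [Finset.card_insert_of_notMem hkW]
    have := Finset.card_pos.2 ⟨k', hk'⟩
    omega
  -- all symbols of the coded segments for `S` agree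
  have hsym : ∀ (i : {i : Fin K // i ∈ S}), ∀ c < σ.symbolCount q S,
      σ.symbol q (σ.uplink v) ⟨S, hS⟩ i c = σ.symbol q (σ.uplink v') ⟨S, hS⟩ i c := by
    intro i c hc
    have hz := hA S hS ⟨k, hkS⟩ (fun i => σ.symbol q (σ.uplink v) ⟨S, hS⟩ i c -
      σ.symbol q (σ.uplink v') ⟨S, hS⟩ i c) ?_ ?_
    · exact sub_eq_zero.1 (congrFun hz i)
    · simp only [symbol, σ.uplink_congr hl, sub_self]
    · intro r
      have : (symbolBasis q).repr
            (∑ i, A S r i * σ.symbol q (σ.uplink v) ⟨S, hS⟩ i c) =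
          (symbolBasis q).repr (∑ i, A S r i * σ.symbol q (σ.uplink v') ⟨S, hS⟩ i c) := by
        ext b
        exact congrFun hd ⟨⟨S, hS⟩, r, ⟨c, hc⟩, b⟩
      simp only [mul_sub, Finset.sum_sub_distrib]
      rw [(symbolBasis q).repr.injective this, sub_self]
  funext t
  obtain ⟨i, hiS, hi⟩ := (σ.cover S hS k hkS (n, t)).2 (by
    rw [hSe]
    exact Finset.mem_filter.2 ⟨Finset.mem_univ _, fun i hi => (Finset.mem_filter.1 hi).2,
      fun i hi hni => hi (by simp [W, hni])⟩)
  have hiS' := Finset.mem_of_mem_erase hiS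
  have hki : k ∈ S.erase i := Finset.mem_erase.2 ⟨(Finset.ne_of_mem_erase hiS).symm, hkS⟩
  obtain ⟨p, hp⟩ := List.mem_iff_getElem?.1 hi
  have hplt : p < σ.upLength S i := by
    refine lt_of_lt_of_le ?_ (Finset.le_sup (f := fun k => (σ.segment S k i).length) hki)
    exact (List.getElem?_eq_some_iff.1 hp).1
  have hW := σ.uplink_eq_of_symbol_eq hq _ _ ⟨S, hS⟩ ⟨i, hiS'⟩ (hsym ⟨i, hiS'⟩) ⟨p, hplt⟩
  simp only [uplink] at hW
  rw [← Finset.add_sum_erase _ _ hki, ← Finset.add_sum_erase _ _ hki,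
    Finset.sum_congr rfl fun j hj => σ.segmentBit_congr hS hiS' (Finset.mem_of_mem_erase hj) hkS
      (Finset.ne_of_mem_erase hj).symm hl p, add_left_inj] at hW
  have hni : n ∈ U i := by rw [hSe] at hiS; exact (Finset.mem_filter.1 hiS).2
  simpa [segmentBit, hp, hni, localValues] using hW

end EvenSplit

/-! ### Communication loads -/

theorem abs_sub_sum_div_card_le_one {ι : Type*} (s : Finset ι) (f : ι → ℕ)
    (hf : ∀ i ∈ s, ∀ i' ∈ s, f i ≤ f i' + 1) {i : ι} (hi : i ∈ s) :
    |(f i : ℝ) - ((∑ i' ∈ s, f i' : ℕ) : ℝ) / s.card| ≤ 1 := by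
  have hs : (0 : ℝ) < s.card := by exact_mod_cast Finset.card_pos.2 ⟨i, hi⟩
  have e : (f i : ℝ) - ((∑ i' ∈ s, f i' : ℕ) : ℝ) / s.card =
      (∑ i' ∈ s, ((f i : ℝ) - f i')) / s.card := by
    rw [Finset.sum_sub_distrib, Finset.sum_const, nsmul_eq_mul]
    push_cast
    field_simp
  rw [e, abs_div, abs_of_pos hs, div_le_one hs]
  calc _ ≤ ∑ i' ∈ s, |(f i : ℝ) - f i'| := Finset.abs_sum_le_sum_abs _ _
    _ ≤ ∑ i' ∈ s, (1 : ℝ) := Finset.sum_le_sum fun i' hi' => by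
        have h1 : (f i : ℝ) ≤ f i' + 1 := by exact_mod_cast hf i hi i' hi'
        have h2 : (f i' : ℝ) ≤ f i + 1 := by exact_mod_cast hf i' hi' i hi
        rw [abs_le]; constructor <;> linarith
    _ = s.card := by simp

/-- The limit of the fraction of the files that are stored exclusively by `s - 1` given users. The
parameter is `s` because these are the users of a set `S` of size `s` other than a fixed one. -/
def exclusiveLimit (K : ℕ) (μ : ℝ) (s : ℕ) : ℝ := μ ^ (s - 1) * (1 - μ) ^ (K - (s - 1))

/-- The sum over the sets of at least two users of a function of their sizes. -/
theorem sum_two_le_card (K : ℕ) (f : ℕ → ℝ) :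
    ∑ S : {S : Finset (Fin K) // 2 ≤ S.card}, f S.1.card =
      ∑ j ∈ Finset.Icc 1 (K - 1), (K.choose (j + 1) : ℝ) * f (j + 1) := by
  rw [← Finset.sum_subtype (Finset.univ.filter fun S : Finset (Fin K) => 2 ≤ S.card) (by simp)
    fun S => f S.card, Finset.sum_filter, ← Finset.powerset_univ,
    Finset.sum_powerset_apply_card fun m => if 2 ≤ m then f m else 0]
  simp only [smul_ite, smul_zero, Finset.card_univ, Fintype.card_fin, nsmul_eq_mul]
  rw [← Finset.sum_filter]
  refine Finset.sum_nbij' (· - 1) (· + 1) ?_ ?_ ?_ ?_ ?_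
  · intro m hm
    simp only [Finset.mem_filter, Finset.mem_range, Finset.mem_Icc] at hm ⊢
    omega
  · intro m hm
    simp only [Finset.mem_filter, Finset.mem_range, Finset.mem_Icc] at hm ⊢
    omega
  · intro m hm
    simp only [Finset.mem_filter, Finset.mem_range] at hm
    omega
  · intro m _
    omega
  · intro m hm
    simp only [Finset.mem_filter, Finset.mem_range] at hm
    rw [Nat.sub_add_cancel (by omega)]

theorem abs_sum_div_sub_sum_le {ι : Type*} (s : Finset ι) {a b : ι → ℝ} {c η : ℝ} {M : ℕ}
    (hM : s.card ≤ M) (hη : 0 ≤ η) (h : ∀ i ∈ s, |a i / c - b i| ≤ η) :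
    |(∑ i ∈ s, a i) / c - ∑ i ∈ s, b i| ≤ M * η := by
  rw [Finset.sum_div, ← Finset.sum_sub_distrib]
  calc _ ≤ ∑ i ∈ s, |a i / c - b i| := Finset.abs_sum_le_sum_abs _ _
    _ ≤ s.card * η := by simpa using Finset.sum_le_sum h
    _ ≤ M * η := by gcongr

namespace EvenSplit

variable {K N T : ℕ} {U : Placement K N}

/-- The segments for user `k` partition the bits of its values in the files that are stored
exclusively by the other users of `S`. -/
theorem sum_length_segment (σ : EvenSplit T U) {S : Finset (Fin K)} (hS : 2 ≤ S.card)
    {k : Fin K} (hk : k ∈ S) :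
    ∑ i ∈ S.erase k, (σ.segment S k i).length = (exclusive U (S.erase k)).card * T := by
  have h : (S.erase k).biUnion (fun i => (σ.segment S k i).toFinset) =
      exclusive U (S.erase k) ×ˢ (Finset.univ : Finset (Fin T)) := by
    ext x
    simp only [Finset.mem_biUnion, List.mem_toFinset, Finset.mem_product, Finset.mem_univ,
      and_true]
    exact σ.cover S hS k hk x
  have hcard := congrArg Finset.card h
  rw [Finset.card_product, Finset.card_univ, Fintype.card_fin, Finset.card_biUnion] at hcard
  · rw [← hcard]
    exact Finset.sum_congr rfl fun i hi =>
      (List.toFinset_card_of_nodup (σ.nodup S hS k hk i hi)).symm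
  · intro i hi i' hi' hii'
    exact List.disjoint_toFinset_iff_disjoint.2 (σ.disjoint S hS k hk i hi i' hi' hii')

/-- If the fractions of exclusively stored files are within `δ` of their limits, then so are, up to
a rounding error of one bit, the normalized lengths of the segments. -/
theorem abs_length_segment_sub_le (σ : EvenSplit T U) (hN : 0 < N) (hT : 0 < T) {μ δ : ℝ}
    (hU : ∀ W : Finset (Fin K), |((exclusive U W).card : ℝ) / N - exclusiveProb W μ| < δ)
    {S : Finset (Fin K)} (hS : 2 ≤ S.card) {k i : Fin K} (hk : k ∈ S) (hi : i ∈ S.erase k) :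
    |((σ.segment S k i).length : ℝ) / (N * T) - exclusiveLimit K μ S.card / (S.card - 1 : ℕ)| ≤
      δ + 1 / N := by
  have hN' : (0 : ℝ) < N := by exact_mod_cast hN
  have hT' : (1 : ℝ) ≤ T := by exact_mod_cast hT
  have hs : (1 : ℝ) ≤ (S.card - 1 : ℕ) := by exact_mod_cast (by omega : 1 ≤ S.card - 1)
  have h1 := abs_sub_sum_div_card_le_one _ _ (σ.even S hS k hk) hi
  rw [σ.sum_length_segment hS hk, Finset.card_erase_of_mem hk] at h1
  have h2 := hU (S.erase k)
  have hp : exclusiveProb (S.erase k) μ = exclusiveLimit K μ S.card := by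
    rw [exclusiveProb, exclusiveLimit, Finset.card_erase_of_mem hk]
  rw [hp] at h2
  set X : ℝ := ((exclusive U (S.erase k)).card : ℝ)
  set j : ℝ := ((S.card - 1 : ℕ) : ℝ)
  set p : ℝ := exclusiveLimit K μ S.card
  set L : ℝ := ((σ.segment S k i).length : ℝ)
  push_cast at h1
  have e : L / (N * T) - p / j = (L - X * T / j) / (N * T) + (X / N - p) / j := by
    field_simp
    ring
  rw [e]
  refine (abs_add_le _ _).trans ?_
  rw [add_comm]
  refine add_le_add ?_ ?_
  · rw [abs_div, abs_of_pos (by linarith : 0 < j)]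
    exact (div_le_self (abs_nonneg _) hs).trans h2.le
  · rw [abs_div, abs_of_pos (by positivity : (0 : ℝ) < N * T)]
    refine div_le_div₀ zero_le_one h1 hN' ?_
    nlinarith

theorem abs_upLength_sub_le (σ : EvenSplit T U) (hN : 0 < N) (hT : 0 < T) {μ δ : ℝ}
    (hU : ∀ W : Finset (Fin K), |((exclusive U W).card : ℝ) / N - exclusiveProb W μ| < δ)
    {S : Finset (Fin K)} (hS : 2 ≤ S.card) {i : Fin K} (hi : i ∈ S) :
    |(σ.upLength S i : ℝ) / (N * T) - exclusiveLimit K μ S.card / (S.card - 1 : ℕ)| ≤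
      δ + 1 / N := by
  have hne : (S.erase i).Nonempty := by
    rw [← Finset.card_pos, Finset.card_erase_of_mem hi]; omega
  obtain ⟨k, hk, h⟩ := Finset.exists_mem_eq_sup _ hne fun k => (σ.segment S k i).length
  rw [upLength, h]
  exact σ.abs_length_segment_sub_le hN hT hU hS (Finset.mem_of_mem_erase hk)
    (Finset.mem_erase.2 ⟨(Finset.ne_of_mem_erase hk).symm, hi⟩)

theorem abs_maxUpLength_sub_le (σ : EvenSplit T U) (hN : 0 < N) (hT : 0 < T) {μ δ : ℝ}
    (hU : ∀ W : Finset (Fin K), |((exclusive U W).card : ℝ) / N - exclusiveProb W μ| < δ)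
    {S : Finset (Fin K)} (hS : 2 ≤ S.card) :
    |(σ.maxUpLength S : ℝ) / (N * T) - exclusiveLimit K μ S.card / (S.card - 1 : ℕ)| ≤
      δ + 1 / N := by
  have hne : S.Nonempty := Finset.card_pos.1 (by omega)
  obtain ⟨i, hi, h⟩ := Finset.exists_mem_eq_sup _ hne
    fun i => σ.upLength S i
  rw [maxUpLength, h]
  exact σ.abs_upLength_sub_le hN hT hU hS hi

theorem abs_symbolCount_sub_le (σ : EvenSplit T U) {q : ℕ} (hq : q ≠ 0) (hN : 0 < N) (hT : 0 < T)
    {μ δ : ℝ} (hU : ∀ W : Finset (Fin K),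
      |((exclusive U W).card : ℝ) / N - exclusiveProb W μ| < δ)
    {S : Finset (Fin K)} (hS : 2 ≤ S.card) :
    |((σ.symbolCount q S * symbolBits q : ℕ) : ℝ) / (N * T) -
      exclusiveLimit K μ S.card / (S.card - 1 : ℕ)| ≤ δ + 1 / N + q / (N * T) := by
  have hNT : (0 : ℝ) < N * T := by exact_mod_cast Nat.mul_pos hN hT
  have h := σ.abs_maxUpLength_sub_le hN hT hU hS
  have hlo : σ.maxUpLength S ≤ σ.symbolCount q S * symbolBits q := by
    have : σ.maxUpLength S ≤ symbolBits q • σ.symbolCount q S :=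
      le_smul_ceilDiv (by rw [symbolBits_eq hq]; omega)
    rwa [smul_eq_mul, mul_comm] at this
  have hhi : σ.symbolCount q S * symbolBits q ≤ σ.maxUpLength S + q := by
    rw [symbolCount, Nat.ceilDiv_eq_add_pred_div, symbolBits_eq hq]
    exact (Nat.div_mul_le_self _ _).trans (by omega)
  have hlo' : (σ.maxUpLength S : ℝ) / (N * T) ≤
      ((σ.symbolCount q S * symbolBits q : ℕ) : ℝ) / (N * T) := by
    gcongr
  have hhi' : ((σ.symbolCount q S * symbolBits q : ℕ) : ℝ) / (N * T) ≤
      (σ.maxUpLength S : ℝ) / (N * T) + q / (N * T) := by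
    rw [← add_div]
    gcongr
    exact_mod_cast hhi
  have hq0 : (0 : ℝ) ≤ q / (N * T) := by positivity
  rw [abs_le] at h ⊢
  constructor <;> linarith [h.1, h.2]

theorem abs_uplinkLoad_sub_le (σ : EvenSplit T U) {q : ℕ} (A : Coefficients K q) (hN : 0 < N)
    (hT : 0 < T) {μ δ : ℝ} (hδ : 0 < δ)
    (hU : ∀ W : Finset (Fin K), |((exclusive U W).card : ℝ) / N - exclusiveProb W μ| < δ) :
    |(σ.scheme A).uplinkLoad - ∑ j ∈ Finset.Icc 1 (K - 1),
        (K.choose (j + 1) : ℝ) * (((j : ℝ) + 1) / j) * μ ^ j * (1 - μ) ^ (K - j)| ≤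
      2 ^ K * (K * (δ + 1 / N)) := by
  have hload : (σ.scheme A).uplinkLoad =
      (∑ S : {S : Finset (Fin K) // 2 ≤ S.card}, ∑ i ∈ S.1, (σ.upLength S.1 i : ℝ)) /
        (N * T) := by
    have hcard : ∀ k, @Fintype.card ((σ.scheme A).UpBit k) ((σ.scheme A).upFintype k) =
        ∑ S ∈ Finset.univ.filter fun S : Finset (Fin K) => 2 ≤ S.card ∧ k ∈ S,
          σ.upLength S k := by
      intro k
      refine Fintype.card_sigma.trans ?_
      simp only [Fintype.card_fin]
      exact (Finset.sum_subtype _ (by simp) fun S => σ.upLength S k).symm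
    have hsum : ∑ S ∈ Finset.univ.filter (fun S : Finset (Fin K) => 2 ≤ S.card),
          ∑ i ∈ S, (σ.upLength S i : ℝ) =
        ∑ S : {S : Finset (Fin K) // 2 ≤ S.card}, ∑ i ∈ S.1, (σ.upLength S.1 i : ℝ) :=
      Finset.sum_subtype _ (by simp) fun S => ∑ i ∈ S, (σ.upLength S i : ℝ)
    rw [ShuffleScheme.uplinkLoad, ← hsum]
    simp only [hcard]
    push_cast
    congr 1
    exact Finset.sum_comm' (by simp [and_comm])
  have hlim : ∑ j ∈ Finset.Icc 1 (K - 1),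
      (K.choose (j + 1) : ℝ) * (((j : ℝ) + 1) / j) * μ ^ j * (1 - μ) ^ (K - j) =
      ∑ S : {S : Finset (Fin K) // 2 ≤ S.card}, ∑ _i ∈ S.1,
        exclusiveLimit K μ S.1.card / (S.1.card - 1 : ℕ) := by
    simp only [Finset.sum_const, nsmul_eq_mul]
    rw [sum_two_le_card K fun s => s * (exclusiveLimit K μ s / (s - 1 : ℕ))]
    refine Finset.sum_congr rfl fun j _ => ?_
    rw [exclusiveLimit, Nat.add_sub_cancel]
    push_cast
    ring
  rw [hload, hlim]
  have hη : (0 : ℝ) ≤ δ + 1 / N := by positivity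
  have h := abs_sum_div_sub_sum_le (c := N * T) (M := 2 ^ K)
    (Finset.univ : Finset {S : Finset (Fin K) // 2 ≤ S.card})
    ((Fintype.card_subtype_le _).trans (by simp)) (by positivity : 0 ≤ K * (δ + 1 / N))
    fun S _ => abs_sum_div_sub_sum_le S.1 (by simpa using Finset.card_le_univ S.1) hη
      fun i hi => σ.abs_upLength_sub_le hN hT hU S.2 hi
  exact_mod_cast h

/-- The term `q / (N * T)` is the cost of padding the coded segments to whole symbols. -/
theorem abs_downlinkLoad_sub_le (σ : EvenSplit T U) {q : ℕ} (hq : q ≠ 0) (A : Coefficients K q)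
    (hN : 0 < N) (hT : 0 < T) {μ δ : ℝ} (hδ : 0 < δ)
    (hU : ∀ W : Finset (Fin K), |((exclusive U W).card : ℝ) / N - exclusiveProb W μ| < δ) :
    |(σ.scheme A).downlinkLoad - ∑ j ∈ Finset.Icc 1 (K - 1),
        (K.choose (j + 1) : ℝ) * μ ^ j * (1 - μ) ^ (K - j)| ≤
      2 ^ K * (K * (δ + 1 / N + q / (N * T))) := by
  have hload : (σ.scheme A).downlinkLoad =
      (∑ S : {S : Finset (Fin K) // 2 ≤ S.card},
        ((S.1.card - 1 : ℕ) : ℝ) * ((σ.symbolCount q S.1 * symbolBits q : ℕ) : ℝ)) /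
          (N * T) := by
    have hcard : @Fintype.card (σ.scheme A).DownBit (σ.scheme A).downFintype =
        ∑ S : {S : Finset (Fin K) // 2 ≤ S.card},
          (S.1.card - 1) * (σ.symbolCount q S.1 * symbolBits q) :=
      (Fintype.card_sigma).trans (by simp)
    rw [ShuffleScheme.downlinkLoad, hcard]
    push_cast
    rfl
  have hlim : ∑ j ∈ Finset.Icc 1 (K - 1),
      (K.choose (j + 1) : ℝ) * μ ^ j * (1 - μ) ^ (K - j) =
      ∑ S : {S : Finset (Fin K) // 2 ≤ S.card}, exclusiveLimit K μ S.1.card := by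
    rw [sum_two_le_card K fun s => exclusiveLimit K μ s]
    refine Finset.sum_congr rfl fun j _ => ?_
    rw [exclusiveLimit, Nat.add_sub_cancel]
    ring
  rw [hload, hlim]
  have hη : (0 : ℝ) ≤ δ + 1 / N + q / (N * T) := by positivity
  have h := abs_sum_div_sub_sum_le (c := N * T) (M := 2 ^ K)
    (a := fun S : {S : Finset (Fin K) // 2 ≤ S.card} =>
      ((S.1.card - 1 : ℕ) : ℝ) * ((σ.symbolCount q S.1 * symbolBits q : ℕ) : ℝ))
    (b := fun S => exclusiveLimit K μ S.1.card) Finset.univ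
    ((Fintype.card_subtype_le _).trans (by simp))
    (by positivity : 0 ≤ K * (δ + 1 / N + q / (N * T))) fun S _ => ?_
  · exact_mod_cast h
  have hS := S.2
  have hs : (0 : ℝ) < (S.1.card - 1 : ℕ) := by exact_mod_cast (by omega : 0 < S.1.card - 1)
  have hsK : ((S.1.card - 1 : ℕ) : ℝ) ≤ K := by
    have := Finset.card_le_univ S.1
    rw [Fintype.card_fin] at this
    exact_mod_cast (by omega : S.1.card - 1 ≤ K)
  have h := σ.abs_symbolCount_sub_le hq hN hT hU S.2
  have e : ((S.1.card - 1 : ℕ) : ℝ) * ((σ.symbolCount q S.1 * symbolBits q : ℕ) : ℝ) / (N * T) -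
      exclusiveLimit K μ S.1.card = (S.1.card - 1 : ℕ) *
        (((σ.symbolCount q S.1 * symbolBits q : ℕ) : ℝ) / (N * T) -
          exclusiveLimit K μ S.1.card / (S.1.card - 1 : ℕ)) := by
    field_simp
  rw [e, abs_mul, abs_of_pos hs]
  gcongr

end EvenSplit

/-! ### Convergence in probability -/

theorem informationLoss_eq {K N : ℕ} (U : Placement K N) :
    informationLoss U = ((exclusive U ∅).card : ℝ) / N := by
  simp [informationLoss, exclusive]

/-- With high probability, all fractions of exclusively stored files are close to their limits and
the coefficients are decodable. -/
theorem tendsto_jointLaw_good (K : ℕ) {μ : ℝ} (m q : ℕ → ℕ) (hm : ∀ N, m N ≤ N)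
    (hμ : Tendsto (fun N => (m N : ℝ) / N) atTop (𝓝 μ)) (hq : Tendsto q atTop atTop)
    {δ : ℝ} (hδ : 0 < δ) :
    Tendsto (fun N => jointLaw K N (m N) (q N)
      ({U | ∀ W : Finset (Fin K), |((exclusive U W).card : ℝ) / N - exclusiveProb W μ| < δ} ×ˢ
        {A | Decodable A})) atTop (𝓝 1) := by
  have h1 := tendsto_placementLaw_exclusive K m hm hμ hδ
  have h2 := tendsto_coefficientLaw_not_decodable K hq
  have h := ENNReal.tendsto_ofReal ((h1.const_sub 1).mul (h2.const_sub 1))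
  simp only [sub_zero, mul_one, ENNReal.ofReal_one] at h
  refine h.congr fun N => ?_
  have := isProbabilityMeasure_placementLaw (K := K) (hm N)
  rw [jointLaw, Measure.prod_prod, ← probReal_compl_eq_one_sub (Set.toFinite _).measurableSet,
    ← probReal_compl_eq_one_sub (Set.toFinite _).measurableSet,
    ENNReal.ofReal_mul measureReal_nonneg, ofReal_measureReal, ofReal_measureReal]
  congr 2
  · ext U; simp
  · ext A; simp

theorem tendsto_floor_mul_div {μ : ℝ} (hμ : 0 ≤ μ) :
    Tendsto (fun N : ℕ => (⌊μ * N⌋₊ : ℝ) / N) atTop (𝓝 μ) :=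
  (tendsto_nat_floor_mul_div_atTop hμ).comp tendsto_natCast_atTop_atTop

end CWDC

end

theorem theorem2 (K : ℕ) (μ : ℝ) (hμ0 : 0 < μ) (hμ1 : μ < 1)
    (T q : ℕ → ℕ) (hT : ∀ N, 0 < T N) (hq : Tendsto q atTop atTop)
    (hqT : (fun N => (q N : ℝ)) =o[atTop] fun N => (N : ℝ) * (T N : ℝ))
    (σ : ∀ (N : ℕ) (U : CWDC.Placement K N), CWDC.EvenSplit (T N) U)
    (ε : ℝ) (hε : 0 < ε) :
    Tendsto
      (fun N : ℕ => CWDC.jointLaw K N ⌊μ * N⌋₊ (q N)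
        {ω | ((σ N ω.1).scheme ω.2).Succeeds ∧
          |CWDC.informationLoss ω.1 - (1 - μ) ^ K| < ε ∧
          |((σ N ω.1).scheme ω.2).uplinkLoad
            - ∑ j ∈ Finset.Icc 1 (K - 1),
                (K.choose (j + 1) : ℝ) * (((j : ℝ) + 1) / j) * μ ^ j * (1 - μ) ^ (K - j)| < ε ∧
          |((σ N ω.1).scheme ω.2).downlinkLoad
            - ∑ j ∈ Finset.Icc 1 (K - 1),
                (K.choose (j + 1) : ℝ) * μ ^ j * (1 - μ) ^ (K - j)| < ε})
      atTop (𝓝 1) := by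
  have hm : ∀ N : ℕ, ⌊μ * N⌋₊ ≤ N := fun N => by
    have h := Nat.floor_mono (mul_le_of_le_one_left (Nat.cast_nonneg (α := ℝ) N) hμ1.le)
    rwa [Nat.floor_natCast] at h
  -- the loads deviate by at most `2 ^ K * K * δ` plus vanishing terms
  set δ : ℝ := ε / (2 ^ K * K + 2) with hδdef
  have hδ : 0 < δ := by positivity
  have hδε : δ < ε := div_lt_self hε (by nlinarith [show (0 : ℝ) ≤ 2 ^ K * K by positivity])
  have hKδ : 2 ^ K * (K * δ) < ε := by
    have : δ * (2 ^ K * K + 2) = ε := div_mul_cancel₀ _ (by positivity)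
    linarith
  have hqT' := hqT.tendsto_div_nhds_zero
  have hinv : Tendsto (fun N : ℕ => 1 / (N : ℝ)) atTop (𝓝 0) := tendsto_one_div_atTop_nhds_zero_nat
  have hup : ∀ᶠ N : ℕ in atTop, 2 ^ K * (K * (δ + 1 / (N : ℝ))) < ε := by
    refine ((((hinv.const_add δ).const_mul (K : ℝ)).const_mul (2 ^ K)).eventually_lt_const ?_)
    simpa using hKδ
  have hdown : ∀ᶠ N : ℕ in atTop, 2 ^ K * (K * (δ + 1 / (N : ℝ) + q N / (N * T N))) < ε := by
    refine (((((hinv.const_add δ).add hqT').const_mul (K : ℝ)).const_mul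
      (2 ^ K)).eventually_lt_const ?_)
    simpa using hKδ
  refine tendsto_of_tendsto_of_tendsto_of_le_of_le'
    (CWDC.tendsto_jointLaw_good K _ q hm (CWDC.tendsto_floor_mul_div hμ0.le) hq hδ)
    tendsto_const_nhds ?_ (Eventually.of_forall fun N => ?_)
  · filter_upwards [hup, hdown, hq.eventually_gt_atTop 0, eventually_gt_atTop 0]
      with N hupN hdownN hqN hN
    refine measure_mono ?_
    rintro ⟨U, A⟩ ⟨hU, hA⟩
    refine ⟨(σ N U).scheme_succeeds hqN.ne' hA, ?_,
      ((σ N U).abs_uplinkLoad_sub_le A hN (hT N) hδ hU).trans_lt hupN,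
      ((σ N U).abs_downlinkLoad_sub_le hqN.ne' A hN (hT N) hδ hU).trans_lt hdownN⟩
    have h := hU ∅
    rw [← CWDC.informationLoss_eq] at h
    simpa [CWDC.exclusiveProb] using h.trans hδε
  · have := CWDC.isProbabilityMeasure_placementLaw (K := K) (hm N)
    unfold CWDC.jointLaw
    exact prob_le_one
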